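/- For integers $k_1,k_2$ let $$\mathrm{Li}_{k_1,k_2}(z)=\sum_{0<m_1<m_2}\frac{z^{m_2}}{m_1^{k_1}m_2^{k_2}}\qquad(|z|<1),$$ and denote by the same symbol its analytic continuation to $\mathbb{C}\setminus[1,\infty)$. Define the multi-poly-Bernoulli numbers $C_m^{(k_1,k_2)}$ by the expansion $$\frac{\mathrm{Li}_{k_1,k_2}(1-e^{-t})}{e^{t}-1}=\sum_{m=0}^{\infty}C_m^{(k_1,k_2)}\frac{t^m}{m!}$$ around $t=0$ (the singularity at $t=0$ is removable). Let $k,n$ be integers with $1\le k<n$. Then the analytic continuation of $\mathrm{Li}_{k,-n}$ to $\mathbb{C}\setminus[1,\infty)$ exists, the integral in $$\widetilde{\xi}(k,-n;s)=\frac{1}{\Gamma(s)}\int_0^\infty t^{s-1}\,\frac{\mathrm{Li}_{k,-n}(1-e^{t})}{e^{-t}-1}\,dt\qquad(\Re(s)>0)$$ converges absolutely for $\Re(s)>0$, and the function $\widetilde{\xi}(k,-n;s)$ so defined extends to an entire function of $s$. The values of this entire function at the nonpositive integers are $$\widetilde{\xi}(k,-n;-m)=C_m^{(k,-n)}\qquad(m\in\mathbb{Z}_{\ge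 0}).$$ -/

import Mathlib

/-- The double polylogarithm series
`∑_{0 < m₁ < m₂} z ^ m₂ / (m₁ ^ k₁ * m₂ ^ k₂)`, absolutely convergent for `‖z‖ < 1`,
summed over `m₂ = m` with inner index `m₁ = j`. -/
noncomputable def doublePolylogSeries (k₁ k₂ : ℤ) (z : ℂ) : ℂ :=
  ∑' m : ℕ, (∑ j ∈ Finset.Ico 1 m, 1 / (j : ℂ) ^ k₁) * (z ^ m / (m : ℂ) ^ k₂)

/-- The complex plane cut along the ray `[1, ∞)`. -/
def cutPlane : Set ℂ := {z : ℂ | 1 - z ∈ Complex.slitPlane}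

/-- `F` is the analytic continuation to the cut plane of the double polylogarithm series on the
open unit disc. As the cut plane is open and connected, `F` is determined on it. -/
def IsDoublePolylog (k₁ k₂ : ℤ) (F : ℂ → ℂ) : Prop :=
  DifferentiableOn ℂ F cutPlane ∧
    Set.EqOn F (doublePolylogSeries k₁ k₂) (Metric.ball 0 1)

open Classical in
/-- The double polylogarithm `Li_{k₁,k₂}` on the cut plane `ℂ ∖ [1, ∞)`: the analytic continuation
of the series on the unit disc. -/
noncomputable def doublePolylog (k₁ k₂ : ℤ) : ℂ → ℂ :=
  if h : ∃ F : ℂ → ℂ, IsDoublePolylog k₁ k₂ F then h.choose else doublePolylogSeries k₁ k₂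

/-- The multi-poly-Bernoulli number `C_m^{(k₁,k₂)}`, defined by the generating function
`Li_{k₁,k₂}(1 - e^{-t}) / (e^t - 1) = ∑ C_m^{(k₁,k₂)} t ^ m / m!` around `t = 0`, that is, the
`m`-th Taylor coefficient, times `m!`, of the left-hand side. Its singularity at `t = 0` is
removable with value `0`, because `Li_{k₁,k₂}(z) = O(z ^ 2)`; this is also the value of the
expression at `t = 0` in Lean. -/
noncomputable def polyBernoulliC (k₁ k₂ : ℤ) (m : ℕ) : ℂ :=
  iteratedDeriv m
    (fun t : ℂ => doublePolylogSeries k₁ k₂ (1 - Complex.exp (-t)) / (Complex.exp t - 1)) 0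

/-- The integrand `t ^ (s - 1) * Li_{k₁,k₂}(1 - e^t) / (e^{-t} - 1)`, for real `t > 0`. -/
noncomputable def xiTildeIntegrand (k₁ k₂ : ℤ) (s : ℂ) (t : ℝ) : ℂ :=
  (t : ℂ) ^ (s - 1) *
    (doublePolylog k₁ k₂ (1 - Complex.exp (t : ℂ)) / (Complex.exp (-(t : ℂ)) - 1))

/-- The function `ξ̃(k₁, k₂; s)`, given by its integral for `Re s > 0`. -/
noncomputable def xiTilde (k₁ k₂ : ℤ) (s : ℂ) : ℂ :=
  1 / Complex.Gamma s * ∫ t in Set.Ioi (0 : ℝ), xiTildeIntegrand k₁ k₂ s t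

open Complex Set Filter Topology Metric Asymptotics MeasureTheory

/-! ### The cut plane -/

/-! Write `θ = z d/dz` and `w = 1/(1 - z)`. Multiplying by `w` turns Taylor coefficients into
partial sums, so `Li_{k,-n} = θ^n (w Li_k - Li_k)`. With `Li_k` built by repeated integration on the
cut plane, this formula is the continuation (`isDoublePolylog_cutDoublePolylog`), unique by the
identity theorem.

On `z = 1 - e^t` one has `w = e^{-t}`, and `Li_i` grows at most like `t^i`. The span of the
`w^{a+1}` and `w^{a+1} Li_i` is stable under `θ` and decays exponentially. It contains `θ^n (w
Li_k)`, and also `θ^n Li_k` because `k < n`: `θ^k Li_k = w - 1`, and one more `θ` kills the constant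
(`isBigO_cutDoublePolylog`).

Let `G` be the kernel of the integral and `e^t G(t) = ∑ a_i t^i` near `0`. Subtracting `e^{-t}
∑_{i<N} a_i t^i` from `G` improves convergence to `Re s > -N`. The subtracted terms contribute `a_i
Γ(s+i)`, which after division by `Γ(s)` are polynomials (`mellinExt`). At `s = -m` the factor `1/Γ`
vanishes and only these polynomials survive. By Leibniz their sum is the `m`-th derivative of
`G(-t)` at `0`, and `G(-t)` is the generating function of the `C_m`
(`sum_taylorCoeff_mul_ascPochhammer`). -/

lemma isOpen_cutPlane : IsOpen cutPlane :=
  isOpen_slitPlane.preimage (continuous_const.sub continuous_id)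

lemma ball_subset_cutPlane : ball (0 : ℂ) 1 ⊆ cutPlane := fun z hz => by
  have := mem_slitPlane_of_norm_lt_one (z := -z) (by simpa using hz)
  simpa [cutPlane, sub_eq_add_neg] using this

lemma zero_mem_cutPlane : (0 : ℂ) ∈ cutPlane := ball_subset_cutPlane (by simp)

lemma cutPlane_mem_nhds {z : ℂ} (hz : z ∈ cutPlane) : cutPlane ∈ 𝓝 z := isOpen_cutPlane.mem_nhds hz

lemma one_sub_ne_zero_of_mem_cutPlane {z : ℂ} (hz : z ∈ cutPlane) : 1 - z ≠ 0 :=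
  slitPlane_ne_zero hz

lemma isPreconnected_cutPlane : IsPreconnected cutPlane := by
  have h : cutPlane = (fun w : ℂ => 1 - w) '' slitPlane := by
    ext z
    simp only [cutPlane, mem_ofPred_eq, mem_image]
    exact ⟨fun h => ⟨1 - z, h, by ring⟩, by rintro ⟨w, hw, rfl⟩; simpa using hw⟩
  rw [h]
  have hs : IsPreconnected slitPlane :=
    (starConvex_one_slitPlane.isPathConnected one_mem_slitPlane).isConnected.isPreconnected
  exact hs.image _ (by fun_prop)

lemma one_sub_exp_mem_cutPlane {u : ℂ} (h₁ : -Real.pi < u.im) (h₂ : u.im < Real.pi) :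
    1 - exp u ∈ cutPlane := by
  simp only [cutPlane, mem_ofPred_eq, sub_sub_cancel]
  rw [mem_slitPlane_iff_arg, arg_exp, toIocMod_eq_self Real.two_pi_pos |>.2 ⟨h₁, by linarith⟩]
  exact ⟨h₂.ne, exp_ne_zero _⟩

lemma one_sub_exp_ofReal_mem_cutPlane (t : ℝ) : 1 - exp (t : ℂ) ∈ cutPlane :=
  one_sub_exp_mem_cutPlane (by simp [Real.pi_pos]) (by simp [Real.pi_pos])

/-- Holomorphic functions on the cut plane have primitives: pull back along `u ↦ 1 - exp u`, which
maps the convex strip `|Im u| < π` onto the cut plane. -/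
lemma exists_primitive_cutPlane {f : ℂ → ℂ} (hf : DifferentiableOn ℂ f cutPlane) :
    ∃ g : ℂ → ℂ, g 0 = 0 ∧ ∀ z ∈ cutPlane, HasDerivAt g (f z) z := by
  set S : Set ℂ := im ⁻¹' Ioo (-Real.pi) Real.pi with hS
  have hSo : IsOpen S := isOpen_Ioo.preimage continuous_im
  have hSc : Convex ℝ S := (convex_Ioo _ _).linear_preimage imLm
  have hd : DifferentiableOn ℂ (fun u => f (1 - exp u) * (-exp u)) S := by
    refine DifferentiableOn.mul (hf.comp (by fun_prop) fun u hu =>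
      one_sub_exp_mem_cutPlane hu.1 hu.2) (by fun_prop)
  obtain ⟨G, hG⟩ := hSc.exists_forall_hasDerivWithinAt hd
  refine ⟨fun z => G (log (1 - z)) - G 0, by simp, fun z hz => ?_⟩
  have hz0 := one_sub_ne_zero_of_mem_cutPlane hz
  have hlog : log (1 - z) ∈ S := by
    have h := (mem_slitPlane_iff_arg.1 hz).1
    exact ⟨by rw [log_im]; exact neg_pi_lt_arg _, by
      rw [log_im]; exact lt_of_le_of_ne (arg_le_pi _) h⟩
  have h1 := (hG _ hlog).hasDerivAt (hSo.mem_nhds hlog)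
  have h2 : HasDerivAt (fun z => log (1 - z)) (-1 / (1 - z)) z :=
    ((hasDerivAt_id z).const_sub 1).clog hz
  have h3 := (h1.comp z h2).sub_const (G 0)
  refine h3.congr_deriv ?_
  rw [exp_log hz0]
  simp only [sub_sub_cancel]
  field_simp

/-- A primitive on the cut plane, vanishing at `0`. -/
noncomputable def cutPrimitive (f : ℂ → ℂ) : ℂ → ℂ :=
  open Classical in
  if hf : DifferentiableOn ℂ f cutPlane then (exists_primitive_cutPlane hf).choose else 0

lemma cutPrimitive_zero (f : ℂ → ℂ) : cutPrimitive f 0 = 0 := by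
  unfold cutPrimitive
  split_ifs with hf
  · exact (exists_primitive_cutPlane hf).choose_spec.1
  · rfl

lemma hasDerivAt_cutPrimitive {f : ℂ → ℂ} (hf : DifferentiableOn ℂ f cutPlane) {z : ℂ}
    (hz : z ∈ cutPlane) : HasDerivAt (cutPrimitive f) (f z) z := by
  rw [cutPrimitive, dif_pos hf]
  exact (exists_primitive_cutPlane hf).choose_spec.2 z hz

/-! ### The Euler operator and Taylor coefficients at the origin -/

/-- The Euler operator `z d/dz`. -/
noncomputable def eulerDeriv (f : ℂ → ℂ) : ℂ → ℂ := fun z => z * deriv f z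

lemma DifferentiableOn.eulerDeriv {f : ℂ → ℂ} {U : Set ℂ} (hf : DifferentiableOn ℂ f U)
    (hU : IsOpen U) : DifferentiableOn ℂ (eulerDeriv f) U :=
  differentiableOn_id.mul (hf.deriv hU)

lemma DifferentiableOn.iterate_eulerDeriv {f : ℂ → ℂ} {U : Set ℂ} (hf : DifferentiableOn ℂ f U)
    (hU : IsOpen U) (n : ℕ) : DifferentiableOn ℂ (_root_.eulerDeriv^[n] f) U := by
  induction n with
  | zero => exact hf
  | succ n ih => rw [Function.iterate_succ_apply']; exact ih.eulerDeriv hU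

lemma Set.EqOn.eulerDeriv {f g : ℂ → ℂ} {U : Set ℂ} (h : EqOn f g U) (hU : IsOpen U) :
    EqOn (eulerDeriv f) (_root_.eulerDeriv g) U := fun z hz => by
  simp only [_root_.eulerDeriv, (h.eventuallyEq_of_mem (hU.mem_nhds hz)).deriv_eq]

lemma Set.EqOn.iterate_eulerDeriv {f g : ℂ → ℂ} {U : Set ℂ} (h : EqOn f g U) (hU : IsOpen U)
    (n : ℕ) : EqOn (_root_.eulerDeriv^[n] f) (_root_.eulerDeriv^[n] g) U := by
  induction n with
  | zero => exact h
  | succ n ih => simp only [Function.iterate_succ_apply']; exact ih.eulerDeriv hU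

lemma DifferentiableOn.analyticAt_zero {f : ℂ → ℂ} (hf : DifferentiableOn ℂ f cutPlane) :
    AnalyticAt ℂ f 0 :=
  hf.analyticAt (cutPlane_mem_nhds zero_mem_cutPlane)

/-- The `m`-th Taylor coefficient at the origin. -/
noncomputable def taylorCoeff (f : ℂ → ℂ) (m : ℕ) : ℂ := iteratedDeriv m f 0 / m.factorial

lemma taylorCoeff_zero (f : ℂ → ℂ) : taylorCoeff f 0 = f 0 := by simp [taylorCoeff]

lemma taylorCoeff_congr {f g : ℂ → ℂ} (h : f =ᶠ[𝓝 0] g) (m : ℕ) :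
    taylorCoeff f m = taylorCoeff g m := by
  simp [taylorCoeff, h.iteratedDeriv_eq m]

lemma taylorCoeff_sub {f g : ℂ → ℂ} (hf : AnalyticAt ℂ f 0) (hg : AnalyticAt ℂ g 0) (m : ℕ) :
    taylorCoeff (fun z => f z - g z) m = taylorCoeff f m - taylorCoeff g m := by
  simp only [taylorCoeff, iteratedDeriv_fun_sub hf.contDiffAt hg.contDiffAt, sub_div]

lemma taylorCoeff_deriv (f : ℂ → ℂ) (m : ℕ) :
    taylorCoeff (deriv f) m = (m + 1) * taylorCoeff f (m + 1) := by
  have := Nat.cast_add_one_ne_zero (R := ℂ) m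
  have := Nat.cast_ne_zero (R := ℂ).2 m.factorial_ne_zero
  simp only [taylorCoeff, iteratedDeriv_succ', Nat.factorial_succ]
  push_cast
  field_simp

lemma taylorCoeff_id_mul {f : ℂ → ℂ} (hf : AnalyticAt ℂ f 0) (m : ℕ) :
    taylorCoeff (fun z => z * f z) (m + 1) = taylorCoeff f m := by
  have := Nat.cast_add_one_ne_zero (R := ℂ) m
  have := Nat.cast_ne_zero (R := ℂ).2 m.factorial_ne_zero
  rw [taylorCoeff, iteratedDeriv_fun_mul contDiffAt_fun_id hf.contDiffAt,
    Finset.sum_eq_single 1 (fun i _ hi => by simp [iteratedDeriv_fun_id_zero, hi])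
      (by simp), taylorCoeff]
  simp only [iteratedDeriv_fun_id_zero, Nat.factorial_succ]
  simp
  field_simp

lemma taylorCoeff_eulerDeriv {f : ℂ → ℂ} (hf : AnalyticAt ℂ f 0) (m : ℕ) :
    taylorCoeff (eulerDeriv f) m = m * taylorCoeff f m := by
  cases m with
  | zero => simp [taylorCoeff_zero, eulerDeriv]
  | succ m =>
    unfold eulerDeriv
    rw [taylorCoeff_id_mul hf.deriv, taylorCoeff_deriv]
    push_cast
    rfl

lemma taylorCoeff_iterate_eulerDeriv {f : ℂ → ℂ} (hf : DifferentiableOn ℂ f cutPlane) (n m : ℕ) :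
    taylorCoeff (eulerDeriv^[n] f) m = m ^ n * taylorCoeff f m := by
  induction n with
  | zero => simp
  | succ n ih =>
    rw [Function.iterate_succ_apply', taylorCoeff_eulerDeriv
      (hf.iterate_eulerDeriv isOpen_cutPlane n).analyticAt_zero, ih, pow_succ]
    ring

lemma differentiableOn_inv_one_sub : DifferentiableOn ℂ (fun z : ℂ => (1 - z)⁻¹) cutPlane :=
  DifferentiableOn.inv (by fun_prop) fun _ hz => one_sub_ne_zero_of_mem_cutPlane hz

lemma taylorCoeff_inv_one_sub_mul {f : ℂ → ℂ} (hf : DifferentiableOn ℂ f cutPlane) (m : ℕ) :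
    taylorCoeff (fun z => (1 - z)⁻¹ * f z) m = ∑ j ∈ Finset.range (m + 1), taylorCoeff f j := by
  have hg : AnalyticAt ℂ (fun z => (1 - z)⁻¹ * f z) 0 :=
    (differentiableOn_inv_one_sub.mul hf).analyticAt_zero
  induction m with
  | zero => simp [taylorCoeff_zero]
  | succ m ih =>
    rw [Finset.sum_range_succ, ← ih]
    -- With `g = f/(1 - z)`, comparing coefficients in `f = g - z g` gives the recursion for partial
    -- sums.
    have h : f =ᶠ[𝓝 0] fun z => (1 - z)⁻¹ * f z - z * ((1 - z)⁻¹ * f z) := by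
      filter_upwards [cutPlane_mem_nhds zero_mem_cutPlane] with z hz
      have := one_sub_ne_zero_of_mem_cutPlane hz
      field_simp
    rw [taylorCoeff_congr h (m + 1), taylorCoeff_sub hg (show AnalyticAt ℂ (fun z => z * ((1 - z)⁻¹ * f z)) 0 from analyticAt_id.mul hg),
      taylorCoeff_id_mul hg]
    ring

lemma hasSum_taylorCoeff {f : ℂ → ℂ} (hf : DifferentiableOn ℂ f cutPlane) {z : ℂ}
    (hz : z ∈ ball (0 : ℂ) 1) : HasSum (fun m => taylorCoeff f m * z ^ m) (f z) := by
  refine (hasSum_taylorSeries_on_ball (hf.mono ball_subset_cutPlane) hz).congr_fun fun m => ?_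
  simp only [taylorCoeff, smul_eq_mul, sub_zero]
  ring

/-! ### Polylogarithms on the cut plane -/

/-- The polylogarithm `Li_i` for `i : ℕ` on the cut plane. -/
noncomputable def cutPolylog : ℕ → ℂ → ℂ
  | 0 => fun z => (1 - z)⁻¹ - 1
  | i + 1 => cutPrimitive (dslope (cutPolylog i) 0)

lemma cutPolylog_at_zero (i : ℕ) : cutPolylog i 0 = 0 := by
  cases i with
  | zero => simp [cutPolylog]
  | succ i => exact cutPrimitive_zero _

lemma differentiableOn_dslope_cutPlane {f : ℂ → ℂ} (hf : DifferentiableOn ℂ f cutPlane) :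
    DifferentiableOn ℂ (dslope f 0) cutPlane :=
  (differentiableOn_dslope (cutPlane_mem_nhds zero_mem_cutPlane)).2 hf

lemma differentiableOn_cutPolylog (i : ℕ) : DifferentiableOn ℂ (cutPolylog i) cutPlane := by
  induction i with
  | zero => exact differentiableOn_inv_one_sub.sub_const 1
  | succ i ih => exact fun z hz => (hasDerivAt_cutPrimitive
      (differentiableOn_dslope_cutPlane ih) hz).differentiableAt.differentiableWithinAt

/-- `dslope` at `0` is division by `z` with the singularity filled in; multiplying by `z` undoes it,
at `0` too, because `Li_i(0) = 0`. -/
lemma eulerDeriv_cutPolylog_succ (i : ℕ) :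
    EqOn (eulerDeriv (cutPolylog (i + 1))) (cutPolylog i) cutPlane := fun z hz => by
  rw [eulerDeriv, cutPolylog, (hasDerivAt_cutPrimitive
    (differentiableOn_dslope_cutPlane (differentiableOn_cutPolylog i)) hz).deriv]
  simpa [cutPolylog_at_zero] using sub_smul_dslope (cutPolylog i) 0 z

lemma iterate_eulerDeriv_cutPolylog (i : ℕ) :
    EqOn (eulerDeriv^[i] (cutPolylog i)) (cutPolylog 0) cutPlane := by
  induction i with
  | zero => exact fun _ _ => rfl
  | succ i ih =>
    rw [Function.iterate_succ_apply]
    exact ((eulerDeriv_cutPolylog_succ i).iterate_eulerDeriv isOpen_cutPlane i).trans ih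

/-- `θ` multiplies the `m`-th coefficient by `m`, so each integration divides by it. Index `0` is
excluded: there the formula would give `1` for `i = 0`. -/
lemma taylorCoeff_cutPolylog (i m : ℕ) :
    taylorCoeff (cutPolylog i) (m + 1) = 1 / ((m + 1 : ℕ) : ℂ) ^ i := by
  induction i with
  | zero =>
    have h : cutPolylog 0 =ᶠ[𝓝 0] fun z => z * ((1 - z)⁻¹ * 1) := by
      filter_upwards [cutPlane_mem_nhds zero_mem_cutPlane] with z hz
      have := one_sub_ne_zero_of_mem_cutPlane hz
      simp only [cutPolylog]
      field_simp
      ring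
    rw [taylorCoeff_congr h, taylorCoeff_id_mul
      (differentiableOn_inv_one_sub.fun_mul (differentiableOn_const 1)).analyticAt_zero,
      taylorCoeff_inv_one_sub_mul (differentiableOn_const 1), Finset.sum_range_succ',
      taylorCoeff_zero]
    simp [taylorCoeff, iteratedDeriv_const]
  | succ i ih =>
    have h : eulerDeriv (cutPolylog (i + 1)) =ᶠ[𝓝 0] cutPolylog i :=
      (eulerDeriv_cutPolylog_succ i).eventuallyEq_of_mem (cutPlane_mem_nhds zero_mem_cutPlane)
    have h' := taylorCoeff_eulerDeriv (differentiableOn_cutPolylog (i + 1)).analyticAt_zero (m + 1)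
    rw [taylorCoeff_congr h, ih] at h'
    have : ((m + 1 : ℕ) : ℂ) ≠ 0 := by exact_mod_cast m.succ_ne_zero
    rw [pow_succ]
    field_simp at h' ⊢
    rw [mul_comm]
    linear_combination -h'

/-! ### The analytic continuation of the double polylogarithm -/

/-- `Li_{k,-n} = (z d/dz)^n (Li_k / (1 - z) - Li_k)` on the cut plane. -/
noncomputable def cutDoublePolylog (k n : ℕ) : ℂ → ℂ :=
  eulerDeriv^[n] fun z => (1 - z)⁻¹ * cutPolylog k z - cutPolylog k z

lemma differentiableOn_cutDoublePolylog (k n : ℕ) :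
    DifferentiableOn ℂ (cutDoublePolylog k n) cutPlane :=
  DifferentiableOn.iterate_eulerDeriv ((differentiableOn_inv_one_sub.mul
    (differentiableOn_cutPolylog k)).sub (differentiableOn_cutPolylog k)) isOpen_cutPlane n

/-- The product with `w` sums over `j ≤ m`; subtracting `Li_k` removes `j = m`, which makes the
inequality `m₁ < m₂` strict. -/
lemma taylorCoeff_cutDoublePolylog (k n m : ℕ) :
    taylorCoeff (cutDoublePolylog k n) m =
      m ^ n * ∑ j ∈ Finset.Ico 1 m, 1 / (j : ℂ) ^ k := by
  have hk := differentiableOn_cutPolylog k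
  have hw := differentiableOn_inv_one_sub.fun_mul hk
  rw [cutDoublePolylog, taylorCoeff_iterate_eulerDeriv (hw.fun_sub hk),
    taylorCoeff_sub hw.analyticAt_zero hk.analyticAt_zero, taylorCoeff_inv_one_sub_mul hk,
    Finset.sum_range_succ, add_sub_cancel_right, Finset.range_eq_Ico]
  congr 1
  cases m with
  | zero => simp
  | succ m =>
    rw [Finset.sum_eq_sum_Ico_succ_bot (by omega), taylorCoeff_zero, cutPolylog_at_zero, zero_add]
    refine Finset.sum_congr rfl fun j hj => ?_
    obtain ⟨j, rfl⟩ := Nat.exists_eq_add_of_le' (Finset.mem_Ico.1 hj).1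
    exact taylorCoeff_cutPolylog k j

lemma isDoublePolylog_cutDoublePolylog (k n : ℕ) :
    IsDoublePolylog k (-(n : ℤ)) (cutDoublePolylog k n) := by
  refine ⟨differentiableOn_cutDoublePolylog k n, fun z hz => ?_⟩
  rw [← (hasSum_taylorCoeff (differentiableOn_cutDoublePolylog k n) hz).tsum_eq,
    doublePolylogSeries]
  refine tsum_congr fun m => ?_
  simp only [taylorCoeff_cutDoublePolylog, zpow_natCast, zpow_neg, div_inv_eq_mul]
  ring

lemma isDoublePolylog_doublePolylog (k n : ℕ) :
    IsDoublePolylog k (-(n : ℤ)) (doublePolylog k (-(n : ℤ))) := by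
  have h : ∃ F, IsDoublePolylog k (-(n : ℤ)) F := ⟨_, isDoublePolylog_cutDoublePolylog k n⟩
  rw [doublePolylog, dif_pos h]
  exact h.choose_spec

/-- By this uniqueness the continuation chosen in `doublePolylog` inherits everything proved for
`cutDoublePolylog`. -/
lemma IsDoublePolylog.eqOn {k₁ k₂ : ℤ} {F G : ℂ → ℂ} (hF : IsDoublePolylog k₁ k₂ F)
    (hG : IsDoublePolylog k₁ k₂ G) : EqOn F G cutPlane := by
  refine AnalyticOnNhd.eqOn_of_preconnected_of_eventuallyEq (hF.1.analyticOnNhd isOpen_cutPlane)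
    (hG.1.analyticOnNhd isOpen_cutPlane) isPreconnected_cutPlane zero_mem_cutPlane ?_
  filter_upwards [ball_mem_nhds (0 : ℂ) one_pos] with z hz
  rw [hF.2 hz, hG.2 hz]

/-! ### Decay along the negative real axis -/

/-- The span of the functions `(1 - z)^{-(a+1)}` and `(1 - z)^{-(a+1)} Li_i(z)`. -/
noncomputable def decaySpan : Submodule ℂ (ℂ → ℂ) :=
  Submodule.span ℂ (range (fun (a : ℕ) (z : ℂ) => (1 - z)⁻¹ ^ (a + 1)) ∪
    range (fun (p : ℕ × ℕ) (z : ℂ) => (1 - z)⁻¹ ^ (p.1 + 1) * cutPolylog p.2 z))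

lemma inv_pow_mem_decaySpan (a : ℕ) : (fun z : ℂ => (1 - z)⁻¹ ^ (a + 1)) ∈ decaySpan :=
  Submodule.subset_span (Or.inl ⟨a, rfl⟩)

lemma inv_pow_mul_cutPolylog_mem_decaySpan (a i : ℕ) :
    (fun z : ℂ => (1 - z)⁻¹ ^ (a + 1) * cutPolylog i z) ∈ decaySpan :=
  Submodule.subset_span (Or.inr ⟨(a, i), rfl⟩)

lemma hasDerivAt_inv_one_sub_pow {z : ℂ} (hz : z ∈ cutPlane) (a : ℕ) :
    HasDerivAt (fun z : ℂ => (1 - z)⁻¹ ^ (a + 1)) ((a + 1) * (1 - z)⁻¹ ^ (a + 2)) z := by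
  have h0 := one_sub_ne_zero_of_mem_cutPlane hz
  have h := ((((hasDerivAt_id z).const_sub 1).inv h0).pow (a + 1))
  refine h.congr_deriv ?_
  simp only [Pi.inv_apply, Nat.add_sub_cancel, id]
  rw [neg_neg, one_div, ← inv_pow, pow_add _ a 2]
  push_cast
  ring

lemma hasDerivAt_cutPolylog {z : ℂ} (hz : z ∈ cutPlane) (i : ℕ) :
    HasDerivAt (cutPolylog i) (deriv (cutPolylog i) z) z :=
  ((differentiableOn_cutPolylog i).differentiableAt (cutPlane_mem_nhds hz)).hasDerivAt

lemma eulerDeriv_inv_one_sub_pow (a : ℕ) :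
    EqOn (eulerDeriv fun z => (1 - z)⁻¹ ^ (a + 1))
      (((a : ℂ) + 1) • ((fun z => (1 - z)⁻¹ ^ (a + 1 + 1)) - fun z => (1 - z)⁻¹ ^ (a + 1)))
      cutPlane := fun z hz => by
  have h0 := one_sub_ne_zero_of_mem_cutPlane hz
  simp only [eulerDeriv, (hasDerivAt_inv_one_sub_pow hz a).deriv, Pi.smul_apply, Pi.sub_apply,
    smul_eq_mul]
  linear_combination -((a : ℂ) + 1) * (1 - z)⁻¹ ^ (a + 1) * mul_inv_cancel₀ h0

lemma eulerDeriv_inv_pow_mul_cutPolylog_succ (a i : ℕ) :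
    EqOn (eulerDeriv fun z => (1 - z)⁻¹ ^ (a + 1) * cutPolylog (i + 1) z)
      (((a : ℂ) + 1) • ((fun z => (1 - z)⁻¹ ^ (a + 1 + 1) * cutPolylog (i + 1) z) -
        fun z => (1 - z)⁻¹ ^ (a + 1) * cutPolylog (i + 1) z) +
        fun z => (1 - z)⁻¹ ^ (a + 1) * cutPolylog i z) cutPlane := fun z hz => by
  have h1 := eulerDeriv_cutPolylog_succ i hz
  have h2 := eulerDeriv_inv_one_sub_pow a hz
  have h3 := ((hasDerivAt_inv_one_sub_pow hz a).mul (hasDerivAt_cutPolylog hz (i + 1))).deriv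
  simp only [eulerDeriv, (hasDerivAt_inv_one_sub_pow hz a).deriv, Pi.smul_apply, Pi.sub_apply,
    smul_eq_mul] at h1 h2
  simp only [eulerDeriv, Pi.add_apply, Pi.smul_apply, Pi.sub_apply, smul_eq_mul]
  refine (congrArg (z * ·) h3).trans ?_
  linear_combination (1 - z)⁻¹ ^ (a + 1) * h1 + cutPolylog (i + 1) z * h2

lemma inv_pow_mul_cutPolylog_zero (a : ℕ) :
    (fun z => (1 - z)⁻¹ ^ (a + 1) * cutPolylog 0 z) =
      (fun z => (1 - z)⁻¹ ^ (a + 1 + 1)) - fun z => (1 - z)⁻¹ ^ (a + 1) := by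
  funext z
  simp only [cutPolylog, Pi.sub_apply]
  ring

lemma differentiableOn_of_mem_decaySpan {f : ℂ → ℂ} (hf : f ∈ decaySpan) :
    DifferentiableOn ℂ f cutPlane := by
  induction hf using Submodule.span_induction with
  | mem f hf =>
    rcases hf with ⟨a, rfl⟩ | ⟨p, rfl⟩
    · exact differentiableOn_inv_one_sub.fun_pow _
    · exact (differentiableOn_inv_one_sub.fun_pow _).fun_mul (differentiableOn_cutPolylog _)
  | zero => exact differentiableOn_const 0
  | add f g _ _ hf hg => exact hf.add hg
  | smul c f _ hf => exact hf.const_smul c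

/-- Since `z w = w - 1`, `θ` sends `w^b` to `b (w^{b+1} - w^b)`, and it lowers the index of `Li_i`.
A factor `w` always remains, and `Li_0 = w - 1` leads back to pure powers. -/
lemma exists_mem_decaySpan_eqOn_eulerDeriv {f : ℂ → ℂ} (hf : f ∈ decaySpan) :
    ∃ g ∈ decaySpan, EqOn (eulerDeriv f) g cutPlane := by
  have hpow : ∀ a : ℕ, ∃ g ∈ decaySpan,
      EqOn (eulerDeriv fun z => (1 - z)⁻¹ ^ (a + 1)) g cutPlane := fun a =>
    ⟨_, decaySpan.smul_mem _ (decaySpan.sub_mem (inv_pow_mem_decaySpan (a + 1))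
      (inv_pow_mem_decaySpan a)), eulerDeriv_inv_one_sub_pow a⟩
  have hadd : ∀ {f g : ℂ → ℂ}, f ∈ decaySpan → g ∈ decaySpan →
      (∃ u ∈ decaySpan, EqOn (eulerDeriv f) u cutPlane) →
      (∃ u ∈ decaySpan, EqOn (eulerDeriv g) u cutPlane) →
      ∃ u ∈ decaySpan, EqOn (eulerDeriv (f + g)) u cutPlane := by
    rintro f g hf hg ⟨u, hu, hfu⟩ ⟨v, hv, hgv⟩
    refine ⟨u + v, decaySpan.add_mem hu hv, fun z hz => ?_⟩
    rw [Pi.add_apply, ← hfu hz, ← hgv hz, eulerDeriv, eulerDeriv, eulerDeriv,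
      deriv_add ((differentiableOn_of_mem_decaySpan hf).differentiableAt (cutPlane_mem_nhds hz))
        ((differentiableOn_of_mem_decaySpan hg).differentiableAt (cutPlane_mem_nhds hz))]
    ring
  have hsmul : ∀ (c : ℂ) {f : ℂ → ℂ}, (∃ u ∈ decaySpan, EqOn (eulerDeriv f) u cutPlane) →
      ∃ u ∈ decaySpan, EqOn (eulerDeriv (c • f)) u cutPlane := by
    rintro c f ⟨u, hu, hfu⟩
    refine ⟨c • u, decaySpan.smul_mem c hu, fun z hz => ?_⟩
    rw [Pi.smul_apply, ← hfu hz, eulerDeriv, eulerDeriv, deriv_const_smul_field, smul_eq_mul,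
      smul_eq_mul]
    ring
  induction hf using Submodule.span_induction with
  | mem f hf =>
    rcases hf with ⟨a, rfl⟩ | ⟨⟨a, i⟩, rfl⟩
    · exact hpow a
    · cases i with
      | zero =>
        dsimp only
        rw [inv_pow_mul_cutPolylog_zero, sub_eq_add_neg, ← neg_one_smul ℂ]
        exact hadd (inv_pow_mem_decaySpan _) (decaySpan.smul_mem _ (inv_pow_mem_decaySpan _))
          (hpow _) (hsmul _ (hpow _))
      | succ i =>
        exact ⟨_, decaySpan.add_mem (decaySpan.smul_mem _ (decaySpan.sub_mem
          (inv_pow_mul_cutPolylog_mem_decaySpan (a + 1) (i + 1))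
          (inv_pow_mul_cutPolylog_mem_decaySpan a (i + 1))))
          (inv_pow_mul_cutPolylog_mem_decaySpan a i), eulerDeriv_inv_pow_mul_cutPolylog_succ a i⟩
  | zero => simpa using hsmul 0 (hpow 0)
  | add f g hf hg ihf ihg => exact hadd hf hg ihf ihg
  | smul c f _ ih => exact hsmul c ih

lemma exists_mem_decaySpan_eqOn_iterate_eulerDeriv {f g : ℂ → ℂ} (hg : g ∈ decaySpan)
    (hfg : EqOn f g cutPlane) (n : ℕ) :
    ∃ g ∈ decaySpan, EqOn (eulerDeriv^[n] f) g cutPlane := by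
  induction n with
  | zero => exact ⟨g, hg, hfg⟩
  | succ n ih =>
    obtain ⟨u, hu, h⟩ := ih
    obtain ⟨v, hv, h'⟩ := exists_mem_decaySpan_eqOn_eulerDeriv hu
    rw [Function.iterate_succ_apply']
    exact ⟨v, hv, (h.eulerDeriv isOpen_cutPlane).trans h'⟩

lemma norm_exp_div_le_two {t : ℝ} (ht : 1 ≤ t) : ‖exp (t : ℂ) / (1 - exp (t : ℂ))‖ ≤ 2 := by
  have h2 : 2 ≤ Real.exp t := by linarith [Real.add_one_le_exp t]
  have : exp (t : ℂ) / (1 - exp (t : ℂ)) = ((Real.exp t / (1 - Real.exp t) : ℝ) : ℂ) := by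
    push_cast; rfl
  rw [this, norm_real, Real.norm_eq_abs, abs_div, abs_of_pos (Real.exp_pos t),
    abs_of_neg (by linarith), div_le_iff₀ (by linarith)]
  linarith

/-- The `t`-derivative of `Li_{i+1}(1 - e^t)` is `-Li_i(1 - e^t) e^t/(1 - e^t)`, whose last factor
is bounded for `t ≥ 1`; the mean value inequality then costs one power of `t`. -/
lemma exists_norm_cutPolylog_one_sub_exp_le (i : ℕ) :
    ∃ C : ℝ, 0 ≤ C ∧ ∀ t : ℝ, 1 ≤ t → ‖cutPolylog i (1 - exp (t : ℂ))‖ ≤ C * t ^ i := by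
  induction i with
  | zero =>
    refine ⟨2, by norm_num, fun t ht => ?_⟩
    have : ‖(exp (t : ℂ))⁻¹‖ ≤ 1 := by
      rw [norm_inv, norm_exp_ofReal]
      exact inv_le_one_of_one_le₀ (Real.one_le_exp (by linarith))
    simp only [cutPolylog, sub_sub_cancel]
    refine (norm_sub_le _ _).trans ?_
    simp only [norm_one, pow_zero]
    linarith
  | succ i ih =>
    obtain ⟨C, hC, h⟩ := ih
    -- The value at `t = 1`, plus the slope bound `2 C t^i` integrated over `[1, t]`.
    refine ⟨‖cutPolylog (i + 1) (1 - exp ((1 : ℝ) : ℂ))‖ + C * 2, by positivity, fun t ht => ?_⟩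
    have hd : ∀ x : ℝ, HasDerivAt (fun x : ℝ => cutPolylog (i + 1) (1 - exp (x : ℂ)))
        (deriv (cutPolylog (i + 1)) (1 - exp (x : ℂ)) * (-exp (x : ℂ))) x := fun x =>
      ((hasDerivAt_cutPolylog (one_sub_exp_ofReal_mem_cutPlane x) (i + 1)).comp (x : ℂ)
        ((hasDerivAt_exp (x : ℂ)).const_sub 1)).comp_ofReal
    have hb := norm_image_sub_le_of_norm_deriv_le_segment' (a := 1) (b := t) (C := C * t ^ i * 2)
      (fun x _ => (hd x).hasDerivWithinAt) (fun x hx => ?_) t ⟨ht, le_rfl⟩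
    · have h1 : (1 : ℝ) ≤ t ^ (i + 1) := one_le_pow₀ ht
      have h2 := norm_sub_norm_le (cutPolylog (i + 1) (1 - exp (t : ℂ)))
        (cutPolylog (i + 1) (1 - exp ((1 : ℝ) : ℂ)))
      have h3 : C * t ^ i * 2 * (t - 1) ≤ C * 2 * t ^ (i + 1) := by
        rw [pow_succ]
        have : 0 ≤ C * t ^ i := by positivity
        nlinarith
      nlinarith [norm_nonneg (cutPolylog (i + 1) (1 - exp ((1 : ℝ) : ℂ)))]
    · have hz : (1 : ℂ) - exp (x : ℂ) ≠ 0 := by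
        have h2 : 2 ≤ Real.exp x := by linarith [Real.add_one_le_exp x, hx.1]
        rw [← ofReal_exp, ← ofReal_one, ← ofReal_sub, ofReal_ne_zero]
        linarith
      have he := eulerDeriv_cutPolylog_succ i (one_sub_exp_ofReal_mem_cutPlane x)
      rw [eulerDeriv] at he
      have : deriv (cutPolylog (i + 1)) (1 - exp (x : ℂ)) * (-exp (x : ℂ)) =
          -(cutPolylog i (1 - exp (x : ℂ)) * (exp (x : ℂ) / (1 - exp (x : ℂ)))) := by
        rw [← he]
        field_simp
      rw [this, norm_neg, norm_mul]
      have hxi : x ^ i ≤ t ^ i := pow_le_pow_left₀ (by linarith [hx.1]) hx.2.le i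
      exact mul_le_mul ((h x hx.1).trans (by gcongr)) (norm_exp_div_le_two hx.1)
        (norm_nonneg _) (by have := hx.1; positivity)

/-- Generators are `O(e^{-t} t^i)`; the rate `1/2` absorbs the power of `t`. -/
lemma isBigO_of_mem_decaySpan {f : ℂ → ℂ} (hf : f ∈ decaySpan) :
    (fun t : ℝ => f (1 - exp (t : ℂ))) =O[atTop] fun t : ℝ => Real.exp (-(1 / 2) * t) := by
  have hw : ∀ a : ℕ, (fun t : ℝ => (1 - (1 - exp (t : ℂ)))⁻¹ ^ (a + 1)) =O[atTop]
      fun t : ℝ => Real.exp (-t) := fun a => by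
    refine IsBigO.of_bound 1 ?_
    filter_upwards [eventually_ge_atTop 0] with t ht
    rw [sub_sub_cancel, norm_pow, norm_inv, norm_exp_ofReal, ← Real.exp_neg, one_mul,
      Real.norm_of_nonneg (Real.exp_pos _).le]
    exact pow_le_of_le_one (Real.exp_pos _).le (Real.exp_le_one_iff.2 (by linarith)) (by omega)
  have hmul : ∀ i : ℕ, (fun t : ℝ => Real.exp (-t) * t ^ i) =O[atTop]
      fun t : ℝ => Real.exp (-(1 / 2) * t) := fun i => by
    have h := (isBigO_refl (fun t : ℝ => Real.exp (-t)) atTop).mul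
      (isLittleO_pow_exp_pos_mul_atTop i (b := 1 / 2) (by norm_num)).isBigO
    refine h.congr_right fun t => ?_
    rw [← Real.exp_add]
    ring_nf
  induction hf using Submodule.span_induction with
  | mem f hf =>
    rcases hf with ⟨a, rfl⟩ | ⟨⟨a, i⟩, rfl⟩
    · exact (hw a).trans (by simpa using hmul 0)
    · obtain ⟨C, -, hC⟩ := exists_norm_cutPolylog_one_sub_exp_le i
      have h : (fun t : ℝ => cutPolylog i (1 - exp (t : ℂ))) =O[atTop] fun t : ℝ => t ^ i := by
        refine IsBigO.of_bound C ?_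
        filter_upwards [eventually_ge_atTop 1] with t ht
        rw [Real.norm_of_nonneg (by positivity)]
        exact hC t ht
      exact ((hw a).mul h).trans (hmul i)
  | zero => exact isBigO_zero _ _
  | add f g _ _ hf hg => exact hf.add hg
  | smul c f _ hf => exact hf.const_smul_left c

/-- Exponential decay of `Li_{k,-n}(1 - e^t)` for `k < n`. -/
lemma isBigO_cutDoublePolylog {k n : ℕ} (hkn : k < n) :
    (fun t : ℝ => cutDoublePolylog k n (1 - exp (t : ℂ))) =O[atTop]
      fun t : ℝ => Real.exp (-(1 / 2) * t) := by
  have hk := differentiableOn_cutPolylog k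
  have hw := differentiableOn_inv_one_sub.fun_mul hk
  obtain ⟨u, hu, hu'⟩ := exists_mem_decaySpan_eqOn_iterate_eulerDeriv
    (inv_pow_mul_cutPolylog_mem_decaySpan 0 k) (f := fun z => (1 - z)⁻¹ * cutPolylog k z)
    (fun z _ => by simp) n
  -- `k < n` supplies the `k + 1` applications of `θ` that take `Li_k` to `θ w`, inside the span.
  obtain ⟨m, rfl⟩ : ∃ m, n = m + (k + 1) := ⟨n - (k + 1), by omega⟩
  have h0 : EqOn (eulerDeriv^[k + 1] (cutPolylog k)) (eulerDeriv fun z => (1 - z)⁻¹ ^ (0 + 1))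
      cutPlane := by
    rw [Function.iterate_succ_apply']
    refine ((iterate_eulerDeriv_cutPolylog k).eulerDeriv isOpen_cutPlane).trans fun z _ => ?_
    simp [eulerDeriv, cutPolylog]
  obtain ⟨g, hg, hg'⟩ := exists_mem_decaySpan_eqOn_eulerDeriv (inv_pow_mem_decaySpan 0)
  obtain ⟨v, hv, hv'⟩ := exists_mem_decaySpan_eqOn_iterate_eulerDeriv hg (h0.trans hg') m
  rw [← Function.iterate_add_apply] at hv'
  have hsub : ∀ N, EqOn (cutDoublePolylog k N) (eulerDeriv^[N] (fun z => (1 - z)⁻¹ * cutPolylog k z)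
      - eulerDeriv^[N] (cutPolylog k)) cutPlane := fun N => by
    induction N with
    | zero => exact fun _ _ => rfl
    | succ N ih =>
      rw [cutDoublePolylog, Function.iterate_succ_apply', ← cutDoublePolylog]
      refine (ih.eulerDeriv isOpen_cutPlane).trans fun z hz => ?_
      have h1 := (hw.iterate_eulerDeriv isOpen_cutPlane N).differentiableAt (cutPlane_mem_nhds hz)
      have h2 := (hk.iterate_eulerDeriv isOpen_cutPlane N).differentiableAt (cutPlane_mem_nhds hz)
      rw [eulerDeriv, deriv_sub h1 h2, Pi.sub_apply, Function.iterate_succ_apply',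
        Function.iterate_succ_apply', eulerDeriv, eulerDeriv, mul_sub]
  refine (isBigO_of_mem_decaySpan (decaySpan.sub_mem hu hv)).congr_left fun t => ?_
  have ht := one_sub_exp_ofReal_mem_cutPlane t
  rw [hsub _ ht, Pi.sub_apply, Pi.sub_apply, hu' ht, hv' ht]

/-! ### Mellin transforms at the nonpositive integers -/

lemma hasMellin_exp_neg_mul_pow {s : ℂ} (i : ℕ) (hs : -(i : ℝ) < s.re) :
    HasMellin (fun t : ℝ => exp (-(t : ℂ)) * (t : ℂ) ^ i) s (Gamma (s + i)) := by
  have hs' : 0 < (s + i).re := by simp; linarith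
  have h : EqOn (fun t : ℝ => ((-t).exp : ℂ) * (t : ℂ) ^ (s + i - 1))
      (fun t : ℝ => (t : ℂ) ^ (s - 1) • (exp (-(t : ℂ)) * (t : ℂ) ^ i)) (Ioi 0) := fun t ht => by
    have ht0 : (t : ℂ) ≠ 0 := ofReal_ne_zero.2 (ne_of_gt ht)
    simp only [smul_eq_mul]
    rw [show s + i - 1 = (s - 1) + i by ring, cpow_add _ _ ht0, cpow_natCast]
    push_cast
    ring
  refine ⟨(GammaIntegral_convergent hs').congr_fun h measurableSet_Ioi, ?_⟩
  rw [Gamma_eq_integral hs', GammaIntegral, mellin]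
  exact (setIntegral_congr_fun measurableSet_Ioi h).symm

lemma Gamma_add_nat_eq {s : ℂ} (hs : 0 < s.re) (i : ℕ) :
    Gamma (s + i) = (ascPochhammer ℂ i).eval s * Gamma s := by
  have h : ∀ m : ℕ, s ≠ -m := by
    rintro m rfl
    simp only [neg_re, natCast_re] at hs
    linarith [m.cast_nonneg (α := ℝ)]
  rw [← Gamma_add_nat_div_Gamma_eq s h, div_mul_cancel₀ _ (Gamma_ne_zero h)]

/-- The remainder `g(t) - e^{-t} ∑_{i < N} a_i t^i`. -/
noncomputable def expRemainder (g : ℝ → ℂ) (a : ℕ → ℂ) (N : ℕ) (t : ℝ) : ℂ :=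
  g t - ∑ i ∈ Finset.range N, a i • (exp (-(t : ℂ)) * (t : ℂ) ^ i)

/-- The continuation of `s ↦ Γ(s)⁻¹ ∫ t^{s-1} g(t) dt` to `-N < Re s`. -/
noncomputable def mellinExt (g : ℝ → ℂ) (a : ℕ → ℂ) (N : ℕ) (s : ℂ) : ℂ :=
  (Gamma s)⁻¹ * mellin (expRemainder g a N) s +
    ∑ i ∈ Finset.range N, a i * (ascPochhammer ℂ i).eval s

/-- `g` is locally integrable and exponentially decreasing, and `e^t g(t)` has the asymptotic
expansion `∑ a_i t^i` as `t → 0+`. -/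
structure HasMellinExpansion (g : ℝ → ℂ) (a : ℕ → ℂ) : Prop where
  locallyIntegrableOn : LocallyIntegrableOn g (Ioi 0)
  isBigO_atTop : g =O[atTop] fun t : ℝ => Real.exp (-(1 / 2) * t)
  isBigO_zero : ∀ N : ℕ, expRemainder g a N =O[𝓝[>] 0] fun t : ℝ => t ^ N

namespace HasMellinExpansion

variable {g : ℝ → ℂ} {a : ℕ → ℂ} (h : HasMellinExpansion g a)
include h

lemma locallyIntegrableOn_expRemainder (N : ℕ) :
    LocallyIntegrableOn (expRemainder g a N) (Ioi 0) := by
  refine h.locallyIntegrableOn.sub (Continuous.locallyIntegrable ?_ |>.locallyIntegrableOn _)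
  fun_prop

lemma isBigO_atTop_expRemainder (N : ℕ) :
    expRemainder g a N =O[atTop] fun t : ℝ => Real.exp (-(1 / 2) * t) := by
  refine h.isBigO_atTop.sub (IsBigO.fun_sum fun i _ => IsBigO.const_mul_left ?_ _)
  have h := (isBigO_refl (fun t : ℝ => Real.exp (-t)) atTop).mul
    (isLittleO_pow_exp_pos_mul_atTop i (b := 1 / 2) (by norm_num)).isBigO
  have h' : (fun t : ℝ => exp (-(t : ℂ)) * (t : ℂ) ^ i) =O[atTop]
      fun t : ℝ => Real.exp (-t) * t ^ i := by
    refine IsBigO.of_bound 1 (Eventually.of_forall fun t => ?_)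
    rw [norm_mul, norm_mul, norm_pow, norm_pow, norm_real, ← ofReal_neg, norm_exp_ofReal, one_mul,
      Real.norm_of_nonneg (Real.exp_pos _).le]
  refine h'.trans (h.congr_right fun t => ?_)
  rw [← Real.exp_add]
  ring_nf

lemma isBigO_zero_rpow (N : ℕ) :
    expRemainder g a N =O[𝓝[>] 0] fun t : ℝ => t ^ (-(-(N : ℝ))) := by
  simpa using h.isBigO_zero N

lemma mellinConvergent_expRemainder {N : ℕ} {s : ℂ} (hs : -(N : ℝ) < s.re) :
    MellinConvergent (expRemainder g a N) s :=
  mellinConvergent_of_isBigO_rpow_exp (by norm_num) (h.locallyIntegrableOn_expRemainder N)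
    (h.isBigO_atTop_expRemainder N) (h.isBigO_zero_rpow N) hs

lemma mellinConvergent {s : ℂ} (hs : 0 < s.re) : MellinConvergent g s := by
  have h0 : expRemainder g a 0 = g := by funext t; simp [expRemainder]
  simpa [h0] using h.mellinConvergent_expRemainder (N := 0) (by simpa)

lemma differentiableAt_mellinExt {N : ℕ} {s : ℂ} (hs : -(N : ℝ) < s.re) :
    DifferentiableAt ℂ (mellinExt g a N) s := by
  have h1 : DifferentiableAt ℂ (mellin (expRemainder g a N)) s :=
    mellin_differentiableAt_of_isBigO_rpow_exp (by norm_num) (h.locallyIntegrableOn_expRemainder N)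
      (h.isBigO_atTop_expRemainder N) (h.isBigO_zero_rpow N) hs
  have h2 : DifferentiableAt ℂ (fun s => (Gamma s)⁻¹) s := differentiable_one_div_Gamma s
  exact (h2.mul h1).add (DifferentiableAt.fun_sum fun i _ =>
    (Polynomial.differentiableAt _).const_mul _)

/-- `Γ(s + i) = (s)_i Γ(s)`, so the polynomial sum restores exactly what the remainder had removed.
-/
lemma mellinExt_eq (N : ℕ) {s : ℂ} (hs : 0 < s.re) :
    mellinExt g a N s = (Gamma s)⁻¹ * mellin g s := by
  have hΓ := Gamma_ne_zero_of_re_pos hs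
  have hpow : ∀ i : ℕ, HasMellin (fun t : ℝ => a i • (exp (-(t : ℂ)) * (t : ℂ) ^ i)) s
      (a i * ((ascPochhammer ℂ i).eval s * Gamma s)) := fun i => by
    have h0 := hasMellin_exp_neg_mul_pow (s := s) i (by
      linarith [i.cast_nonneg (α := ℝ)])
    have h1 := hasMellin_const_smul h0.1 (a i)
    rwa [h0.2, Gamma_add_nat_eq hs, smul_eq_mul] at h1
  have hsum : HasMellin (fun t : ℝ => ∑ i ∈ Finset.range N, a i • (exp (-(t : ℂ)) * (t : ℂ) ^ i)) s
      (∑ i ∈ Finset.range N, a i * ((ascPochhammer ℂ i).eval s * Gamma s)) := by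
    induction N with
    | zero => simp [HasMellin, MellinConvergent, mellin, IntegrableOn]
    | succ N ih =>
      simp only [Finset.sum_range_succ]
      have := hasMellin_add ih.1 (hpow N).1
      rwa [ih.2, (hpow N).2] at this
  have hsub := (hasMellin_sub (h.mellinConvergent hs) hsum.1).2
  rw [mellinExt, show expRemainder g a N = fun t => g t - _ from rfl, hsub, hsum.2, mul_sub,
    Finset.mul_sum, sub_add, ← Finset.sum_sub_distrib, Finset.sum_eq_zero, sub_zero]
  intro i _
  field_simp
  ring

lemma mellinExt_congr {N M : ℕ} {s : ℂ} (hN : -(N : ℝ) < s.re) (hM : -(M : ℝ) < s.re) :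
    mellinExt g a N s = mellinExt g a M s := by
  set U : Set ℂ := {z | max (-(N : ℝ)) (-(M : ℝ)) < z.re} with hU
  have hUo : IsOpen U := isOpen_lt continuous_const continuous_re
  have hUc : IsPreconnected U := (convex_halfSpace_re_gt _).isPreconnected
  have hd : ∀ K : ℕ, -(K : ℝ) ≤ max (-(N : ℝ)) (-(M : ℝ)) →
      AnalyticOnNhd ℂ (mellinExt g a K) U := fun K hK =>
    DifferentiableOn.analyticOnNhd (fun z hz => (h.differentiableAt_mellinExt
      (hK.trans_lt hz)).differentiableWithinAt) hUo
  have h1 : (1 : ℂ) ∈ U := by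
    simp only [hU, mem_ofPred_eq, one_re, max_lt_iff]
    constructor <;> linarith [N.cast_nonneg (α := ℝ), M.cast_nonneg (α := ℝ)]
  refine (hd N (le_max_left _ _)).eqOn_of_preconnected_of_eventuallyEq (hd M (le_max_right _ _))
    hUc h1 ?_ (max_lt hN hM)
  filter_upwards [(isOpen_lt continuous_const continuous_re).mem_nhds
    (show (0 : ℝ) < (1 : ℂ).re by simp)] with z hz
  rw [h.mellinExt_eq N hz, h.mellinExt_eq M hz]

/-- Entire continuation of `Γ(s)⁻¹ ∫ t^{s-1} g(t) dt` and its values at nonpositive integers. -/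
theorem exists_entire : ∃ Ξ : ℂ → ℂ, Differentiable ℂ Ξ ∧
    (∀ s : ℂ, 0 < s.re → Ξ s = (Gamma s)⁻¹ * mellin g s) ∧
    ∀ m : ℕ, Ξ (-(m : ℂ)) =
      ∑ i ∈ Finset.range (m + 1), a i * (ascPochhammer ℂ i).eval (-(m : ℂ)) := by
  have hN : ∀ s : ℂ, -((⌊‖s‖⌋₊ + 1 : ℕ) : ℝ) < s.re := fun s => by
    have h1 := Nat.lt_floor_add_one ‖s‖
    have h2 := neg_le_of_abs_le (abs_re_le_norm s)
    push_cast
    linarith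
  have key : ∀ (N : ℕ) (s : ℂ), -(N : ℝ) < s.re →
      mellinExt g a (⌊‖s‖⌋₊ + 1) s = mellinExt g a N s := fun N s hs =>
    h.mellinExt_congr (hN s) hs
  -- The order `⌊‖s‖⌋ + 1` exceeds `-Re s`; near any point it may be frozen by `key`, which gives
  -- differentiability.
  refine ⟨fun s => mellinExt g a (⌊‖s‖⌋₊ + 1) s, fun s => ?_, fun s hs => h.mellinExt_eq _ hs,
    fun m => ?_⟩
  · refine (h.differentiableAt_mellinExt (hN s)).congr_of_eventuallyEq ?_
    filter_upwards [(isOpen_lt continuous_const continuous_re).mem_nhds (hN s)] with z hz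
    exact key _ z hz
  · simp only
    -- Lean's `Gamma (-m) = 0` and `0⁻¹ = 0` give the true value of `1/Γ` at its zero.
    rw [key (m + 1) _ (by simp), mellinExt, Gamma_neg_nat_eq_zero, inv_zero, zero_mul, zero_add]

end HasMellinExpansion

lemma ascPochhammer_eval_neg_natCast (m i : ℕ) :
    (ascPochhammer ℂ i).eval (-(m : ℂ)) = (-1) ^ i * m.descFactorial i := by
  rw [ascPochhammer_eval_neg_eq_descPochhammer, descPochhammer_eval_eq_descFactorial]

/-- The Taylor expansion of `e^t G(t)` gives an expansion of `G` restricted to the positive reals,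
for `G` analytic at the origin. -/
lemma isBigO_expRemainder {G : ℂ → ℂ} (hG : AnalyticAt ℂ G 0) (N : ℕ) :
    expRemainder (fun t : ℝ => G t) (taylorCoeff fun t => exp t * G t) N
      =O[𝓝[>] 0] fun t : ℝ => t ^ N := by
  have hF : AnalyticAt ℂ (fun t => exp t * G t) 0 := analyticAt_cexp.mul hG
  have h1 := hF.hasFPowerSeriesAt.isBigO_sub_partialSum_pow N
  have hlim : Tendsto (fun t : ℝ => (t : ℂ)) (𝓝[>] 0) (𝓝 0) := by
    have : Tendsto (fun t : ℝ => (t : ℂ)) (𝓝 0) (𝓝 0) := by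
      simpa using continuous_ofReal.tendsto (0 : ℝ)
    exact this.mono_left nhdsWithin_le_nhds
  have h2 := h1.comp_tendsto hlim
  have h3 : (fun t : ℝ => exp (-(t : ℂ))) =O[𝓝[>] 0] fun _ => (1 : ℝ) := by
    refine Tendsto.isBigO_one ℝ (c := exp (-0)) ?_
    exact (continuous_exp.tendsto _).comp hlim.neg
  refine ((h3.mul h2).congr_left fun t => ?_).trans (IsBigO.of_bound 1
    (Eventually.of_forall fun t => by simp))
  simp only [Function.comp, zero_add, FormalMultilinearSeries.partialSum, expRemainder,
    FormalMultilinearSeries.ofScalars_apply_eq, taylorCoeff, smul_eq_mul, mul_sub, Finset.mul_sum]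
  congr 1
  · rw [← mul_assoc, ← exp_add]; simp
  · exact Finset.sum_congr rfl fun i _ => by ring

/-- Leibniz for `G(-t) = F(-t) e^t` with `F(t) = e^t G(t)`: the sign `(-1)^i` and `i! * m.choose i`
combine into the rising factorial of `-m`. -/
lemma sum_taylorCoeff_mul_ascPochhammer {G : ℂ → ℂ} (hG : AnalyticAt ℂ G 0) (m : ℕ) :
    ∑ i ∈ Finset.range (m + 1),
      taylorCoeff (fun t => exp t * G t) i * (ascPochhammer ℂ i).eval (-(m : ℂ)) =
      iteratedDeriv m (fun t => G (-t)) 0 := by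
  have hF : AnalyticAt ℂ (fun t => exp t * G t) 0 := analyticAt_cexp.mul hG
  have hGF : (fun t => G (-t)) = fun t => (fun t => exp t * G t) (-t) * exp t := by
    funext t
    rw [mul_right_comm, ← exp_add, neg_add_cancel, exp_zero, one_mul]
  have hFn : AnalyticAt ℂ (fun t => (fun t => exp t * G t) (-t)) 0 :=
    AnalyticAt.fun_comp (f := fun t : ℂ => -t) (by rwa [neg_zero]) analyticAt_id.neg
  rw [hGF, iteratedDeriv_fun_mul hFn.contDiffAt analyticAt_cexp.contDiffAt]
  refine Finset.sum_congr rfl fun i _ => ?_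
  have := Nat.cast_ne_zero (R := ℂ).2 i.factorial_ne_zero
  rw [iteratedDeriv_comp_neg i (fun t => exp t * G t), ascPochhammer_eval_neg_natCast,
    Nat.descFactorial_eq_factorial_mul_choose, neg_zero, taylorCoeff, iteratedDeriv_eq_iterate (f := exp),
    iter_deriv_exp, exp_zero, smul_eq_mul]
  push_cast
  field_simp

/-! ### The kernel of the zeta function -/

/-- `F(z) (1 - z) / z`, with the singularity at `z = 0` removed when `F 0 = 0`. -/
noncomputable def cutKernel (F : ℂ → ℂ) (z : ℂ) : ℂ := (1 - z) * dslope F 0 z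

lemma differentiableOn_cutKernel {F : ℂ → ℂ} (hF : DifferentiableOn ℂ F cutPlane) :
    DifferentiableOn ℂ (cutKernel F) cutPlane :=
  DifferentiableOn.fun_mul (by fun_prop) (differentiableOn_dslope_cutPlane hF)

/-- When `e^u = 1` the right side is Lean's `0 / 0 = 0`; the hypothesis on the derivative makes the
filled-in value `0` as well. -/
lemma cutKernel_one_sub_exp {F : ℂ → ℂ} (h0 : F 0 = 0) (h1 : deriv F 0 = 0) (u : ℂ) :
    cutKernel F (1 - exp u) = F (1 - exp u) / (exp (-u) - 1) := by
  by_cases hu : exp u = 1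
  · simp [cutKernel, hu, h0, h1]
  · have hz : 1 - exp u ≠ 0 := sub_ne_zero.2 (Ne.symm hu)
    have hz' : exp (-u) - 1 = (1 - exp u) / exp u := by
      rw [exp_neg]
      field_simp [exp_ne_zero u]
    rw [cutKernel, dslope_of_ne _ hz, slope_def_field, h0, hz', sub_zero, sub_zero]
    field_simp [exp_ne_zero u]
    ring

lemma IsDoublePolylog.map_zero {k n : ℕ} {F : ℂ → ℂ} (hF : IsDoublePolylog k (-(n : ℤ)) F) :
    F 0 = 0 := by
  rw [hF.eqOn (isDoublePolylog_cutDoublePolylog k n) zero_mem_cutPlane,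
    ← taylorCoeff_zero (cutDoublePolylog k n),
    taylorCoeff_cutDoublePolylog]
  simp

/-- The coefficient of `z` is a sum over the empty range `0 < j < 1`. -/
lemma IsDoublePolylog.deriv_zero {k n : ℕ} {F : ℂ → ℂ} (hF : IsDoublePolylog k (-(n : ℤ)) F) :
    deriv F 0 = 0 := by
  have h : taylorCoeff F 1 = 0 := by
    rw [taylorCoeff_congr ((hF.eqOn (isDoublePolylog_cutDoublePolylog k n)).eventuallyEq_of_mem
      (cutPlane_mem_nhds zero_mem_cutPlane)), taylorCoeff_cutDoublePolylog]
    simp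
  simpa [taylorCoeff] using h

lemma analyticAt_cutKernel_one_sub_exp {F : ℂ → ℂ} (hF : DifferentiableOn ℂ F cutPlane) :
    AnalyticAt ℂ (fun u => cutKernel F (1 - exp u)) 0 := by
  refine AnalyticAt.fun_comp (g := cutKernel F) (f := fun u => 1 - exp u) ?_
    (analyticAt_const.sub analyticAt_cexp)
  simpa using (differentiableOn_cutKernel hF).analyticAt_zero

lemma hasMellinExpansion_cutKernel {k n : ℕ} (hkn : k < n) {F : ℂ → ℂ}
    (hF : IsDoublePolylog k (-(n : ℤ)) F) :
    HasMellinExpansion (fun t : ℝ => cutKernel F (1 - exp (t : ℂ)))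
      (taylorCoeff fun u => exp u * cutKernel F (1 - exp u)) where
  locallyIntegrableOn := by
    refine Continuous.locallyIntegrable ?_ |>.locallyIntegrableOn _
    exact (differentiableOn_cutKernel hF.1).continuousOn.comp_continuous (by fun_prop)
      one_sub_exp_ofReal_mem_cutPlane
  isBigO_atTop := by
    refine IsBigO.trans (IsBigO.of_bound 2 ?_) (isBigO_cutDoublePolylog hkn)
    filter_upwards [eventually_ge_atTop 1] with t ht
    have hz := one_sub_exp_ofReal_mem_cutPlane t
    rw [← hF.eqOn (isDoublePolylog_cutDoublePolylog k n) hz]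
    have h2 : 2 ≤ Real.exp t := by linarith [Real.add_one_le_exp t]
    have hne : (1 : ℂ) - exp (t : ℂ) ≠ 0 := by
      rw [← ofReal_exp, ← ofReal_one, ← ofReal_sub, ofReal_ne_zero]
      linarith
    rw [cutKernel, dslope_of_ne _ hne, slope_def_field, hF.map_zero, sub_zero, sub_zero,
      sub_sub_cancel, mul_div_left_comm, norm_mul, mul_comm]
    exact mul_le_mul_of_nonneg_right (norm_exp_div_le_two ht) (norm_nonneg _)
  isBigO_zero := isBigO_expRemainder (analyticAt_cutKernel_one_sub_exp hF.1)

lemma xiTildeIntegrand_eq (k n : ℕ) (s : ℂ) (t : ℝ) :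
    xiTildeIntegrand k (-(n : ℤ)) s t =
      (t : ℂ) ^ (s - 1) • cutKernel (doublePolylog k (-(n : ℤ))) (1 - exp (t : ℂ)) := by
  have hD := isDoublePolylog_doublePolylog k n
  rw [cutKernel_one_sub_exp hD.map_zero hD.deriv_zero, xiTildeIntegrand, smul_eq_mul]

/-- Only the germ at `0` matters, and there `1 - e^{-t}` lies in the unit disc, where continuation
and series agree. -/
lemma polyBernoulliC_eq (k n m : ℕ) :
    polyBernoulliC k (-(n : ℤ)) m =
      iteratedDeriv m
        (fun t : ℂ => cutKernel (doublePolylog k (-(n : ℤ))) (1 - exp (-t))) 0 := by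
  have hD := isDoublePolylog_doublePolylog k n
  refine Filter.EventuallyEq.iteratedDeriv_eq m ?_
  have hlim : Tendsto (fun t : ℂ => 1 - exp (-t)) (𝓝 0) (𝓝 0) := by
    have h : ContinuousAt (fun t : ℂ => 1 - exp (-t)) 0 := by fun_prop
    simpa [ContinuousAt] using h
  filter_upwards [hlim.eventually (ball_mem_nhds 0 one_pos)] with t ht
  rw [cutKernel_one_sub_exp hD.map_zero hD.deriv_zero, neg_neg, hD.2 ht]

theorem mainTheorem10 (k n : ℕ) (hk : 1 ≤ k) (hkn : k < n) :
    IsDoublePolylog (k : ℤ) (-(n : ℤ)) (doublePolylog (k : ℤ) (-(n : ℤ))) ∧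
    (∀ s : ℂ, 0 < s.re →
      MeasureTheory.IntegrableOn (xiTildeIntegrand (k : ℤ) (-(n : ℤ)) s) (Set.Ioi (0 : ℝ))) ∧
    ∃ Ξ : ℂ → ℂ, Differentiable ℂ Ξ ∧
      (∀ s : ℂ, 0 < s.re → Ξ s = xiTilde (k : ℤ) (-(n : ℤ)) s) ∧
      ∀ m : ℕ, Ξ (-(m : ℂ)) = polyBernoulliC (k : ℤ) (-(n : ℤ)) m := by
  have hD := isDoublePolylog_doublePolylog k n
  have hM := hasMellinExpansion_cutKernel hkn hD
  have hI : ∀ s, xiTildeIntegrand (k : ℤ) (-(n : ℤ)) s = fun t : ℝ => (t : ℂ) ^ (s - 1) •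
      cutKernel (doublePolylog k (-(n : ℤ))) (1 - exp (t : ℂ)) := fun s =>
    funext (xiTildeIntegrand_eq k n s)
  refine ⟨hD, fun s hs => ?_, ?_⟩
  · rw [hI]
    exact hM.mellinConvergent hs
  · obtain ⟨Ξ, hd, hpos, hneg⟩ := hM.exists_entire
    refine ⟨Ξ, hd, fun s hs => ?_, fun m => ?_⟩
    · rw [hpos s hs, xiTilde, hI, one_div, mellin]
    · rw [hneg, polyBernoulliC_eq,
        sum_taylorCoeff_mul_ascPochhammer (analyticAt_cutKernel_one_sub_exp hD.1)]
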